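/- Let $n\ge 3$. All functions are real-valued and $C^\infty$ on the whole space of their variables; a subscript $m\ge 0$ of a function $F_m$ means that it is a function of $(x,p_0,\dots,p_m)\in\mathbb{R}^{m+2}$. Write $\partial_k=\partial/\partial p_k$, $D_0=\partial_x$, $D_m=\partial_x+p_1\partial_0+\cdots+p_m\partial_{m-1}$ for $m\ge1$, and $E_m^k=\sum_{j=0}^{k}(-1)^jD_m^{\,j}\partial_j$ (where $D_m^{\,j}$ is a power and the superscript in $E_m^k$ is not). Write $\int^{p_k}F=\int_0^{p_k}F(x,p_0,\dots,p_{k-1},t,p_{k+1},\dots)\,dt$ and $\int^{p_k}\!\!\int F=\int_0^{p_k}\!\int_0^{t}F(x,p_0,\dots,p_{k-1},s,p_{k+1},\dots)\,ds\,dt$. Then functions $f_{2n-1}$, $\rho_n$, $L_n$ satisfy $\rho_n>0$ and $$\rho_n\,(p_{2n}-f_{2n-1})=E_{2n}^nL_n\qquad\text{for all }(x,p_0,\dots,p_{2n})$$ if and only if there are $n+2$ functions $R_n$, $f_0,f_1,\dots,f_{n-1}$ and $N_{n-1}$ such that $$f_{2n-1}=n\,D_{n+1}R_n\cdot p_{2n-1}-e^{R_n}\Big[(-1)^nE_{2n-2}^n\int^{p_n}\!\!\!\int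 e^{-R_n}+\sum_{\ell=1}^{n-1}\Big(f_\ell\,p_{2\ell}+(-1)^\ell E_{2\ell-1}^{\ell}\int^{p_\ell}\!\!\!\int f_\ell\Big)+f_0\Big],$$ $$\rho_n=e^{-R_n},\qquad L_n=(-1)^n\int^{p_n}\!\!\!\int e^{-R_n}+\sum_{\ell=1}^{n-1}(-1)^\ell\int^{p_\ell}\!\!\!\int f_\ell+\int^{p_0}f_0+D_nN_{n-1}.$$ The functions $R_n,f_0,\dots,f_{n-1},N_{n-1}$ are free: every choice of them yields, through these formulas, functions $f_{2n-1},\rho_n,L_n$ of the indicated variables that solve the equation with $\rho_n>0$. Whenever the equation is solved with $\rho_n>0$, $f_{2n-1}$ is linear (that is, affine) in $p_{2n-1}$: $f_{2n-1}=a\,p_{2n-1}+b$ with $a$, $b$ functions of $(x,p_0,\dots,p_{2n-2})$. -/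

import Mathlib

open scoped ContDiff

namespace MultiplierProblem

/-- Points `(x, p)` with `p = (p₀, p₁, p₂, …)`. Every function below depends on finitely many of
the variables `p k` only, see `SmoothOfOrder`. -/
abbrev Jet : Type := ℝ × (ℕ → ℝ)

/-- `F` is a smooth function of the variables `x, p₀, …, p_m` (on all of `ℝ^(m+2)`). -/
def SmoothOfOrder (m : ℕ) (F : Jet → ℝ) : Prop :=
  ∃ g : ℝ × (Fin (m + 1) → ℝ) → ℝ, ContDiff ℝ ∞ g ∧
    ∀ (x : ℝ) (p : ℕ → ℝ), F (x, p) = g (x, fun i => p i)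

/-- The partial derivative `∂F/∂x`. -/
noncomputable def partialX (F : Jet → ℝ) : Jet → ℝ :=
  fun z => deriv (fun t => F (t, z.2)) z.1

/-- The partial derivative `∂_k F = ∂F/∂p_k`. -/
noncomputable def partialP (k : ℕ) (F : Jet → ℝ) : Jet → ℝ :=
  fun z => deriv (fun t => F (z.1, Function.update z.2 k t)) (z.2 k)

/-- The truncated total derivative
`D_m = ∂_x + p₁ ∂₀ + p₂ ∂₁ + ⋯ + p_m ∂_{m-1}` (so `D_0 = ∂_x`). -/
noncomputable def totalD (m : ℕ) (F : Jet → ℝ) : Jet → ℝ :=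
  fun z => partialX F z + ∑ k ∈ Finset.range m, z.2 (k + 1) * partialP k F z

/-- The Euler–Lagrange operator `E_m^n = ∑_{k=0}^n (-1)^k (D_m)^k ∂_k`
(the first argument is the subscript `m`, the second one the superscript `n`). -/
noncomputable def eulerLagrange (m n : ℕ) (F : Jet → ℝ) : Jet → ℝ :=
  fun z => ∑ k ∈ Finset.range (n + 1), (-1 : ℝ) ^ k * ((totalD m)^[k] (partialP k F)) z

/-- The anti-derivative `∫_0^{p_k} F(x, p₀, …, p_{k-1}, t, p_{k+1}, …) dt`. -/
noncomputable def antiP (k : ℕ) (F : Jet → ℝ) : Jet → ℝ :=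
  fun z => ∫ t in (0 : ℝ)..z.2 k, F (z.1, Function.update z.2 k t)

/-- The second anti-derivative `∫_0^{p_k} ∫_0^t F(x, p₀, …, p_{k-1}, s, p_{k+1}, …) ds dt`. -/
noncomputable def antiP₂ (k : ℕ) (F : Jet → ℝ) : Jet → ℝ :=
  fun z => ∫ t in (0 : ℝ)..z.2 k, ∫ s in (0 : ℝ)..t, F (z.1, Function.update z.2 k s)

/-- The triple `(f, ρ, L) = (f_{2n-1}, ρ_n, L_n)` solves the multiplier problem of order `2n`:
`ρ_n (p_{2n} - f_{2n-1}) = E_{2n}^n L_n` identically, with `ρ_n > 0`. -/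
structure SolvesMultiplierProblem (n : ℕ) (f ρ L : Jet → ℝ) : Prop where
  smooth_f : SmoothOfOrder (2 * n - 1) f
  smooth_ρ : SmoothOfOrder n ρ
  smooth_L : SmoothOfOrder n L
  pos : ∀ z, 0 < ρ z
  eq : ∀ z : Jet, ρ z * (z.2 (2 * n) - f z) = eulerLagrange (2 * n) n L z

/-- The integral form of `(f, ρ, L) = (f_{2n-1}, ρ_n, L_n)` with parameters
`R = R_n`, `φ k = f_k` for `0 ≤ k ≤ n - 1`, and `N = N_{n-1}`. -/
structure HasIntegralForm (n : ℕ) (R : Jet → ℝ) (φ : ℕ → Jet → ℝ) (N : Jet → ℝ)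
    (f ρ L : Jet → ℝ) : Prop where
  f_eq : ∀ z : Jet, f z =
    n * totalD (n + 1) R z * z.2 (2 * n - 1)
      - Real.exp (R z) *
        ((-1 : ℝ) ^ n * eulerLagrange (2 * n - 2) n (antiP₂ n fun w => Real.exp (-R w)) z
          + ∑ l ∈ Finset.Icc 1 (n - 1),
              (φ l z * z.2 (2 * l)
                + (-1 : ℝ) ^ l * eulerLagrange (2 * l - 1) l (antiP₂ l (φ l)) z)
          + φ 0 z)
  ρ_eq : ∀ z : Jet, ρ z = Real.exp (-R z)
  L_eq : ∀ z : Jet, L z =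
    (-1 : ℝ) ^ n * antiP₂ n (fun w => Real.exp (-R w)) z
      + ∑ l ∈ Finset.Icc 1 (n - 1), (-1 : ℝ) ^ l * antiP₂ l (φ l) z
      + antiP 0 (φ 0) z
      + totalD n N z

end MultiplierProblem

open MultiplierProblem

/-!
The equation is linear in the Lagrangian, so the proof rests on a normal form for Lagrangians and
on the Euler–Lagrange expression of each of its summands.

*Normal form* (`exists_eq_sum_antiP₂`). For `L` of order `m`, Taylor's formula in `p_m` gives
`L = a + b p_m + ∫∫ ∂_m² L` with `a`, `b` of order `m - 1`. The affine term `b p_m` is the highest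
term of the total derivative of `∫^{p_{m-1}} b`, and what is left has order `m - 1`. By induction `L`
is a sum of double primitives `± ∫∫ φ_l` with `φ_l` of order `l`, a primitive `∫ φ_0`, and a total
derivative; the latter is annihilated by the Euler–Lagrange operator, because the sum telescopes
by `[∂_{k+1}, D] = ∂_k` (`eulerLagrange_totalD`).

*Highest terms*. The same commutator gives the derivatives of `D^k B` by its two highest variables
(`partialP_totalD_iterate_top`, `partialP_totalD_iterate_subtop`). Hence the expression of a
function `A` of order `l` is `± p_{2l} ∂_l² A` plus an expression of order `2l - 1`
(`eulerLagrange_eq_top`). For `l = n` one more order is split off: the coefficient of `p_{2n-1}` is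
`± n D ∂_n² A`, since the terms with `∂_{n-1} ∂_n A` cancel (`eulerLagrange_eq_top_two`); `n ≥ 3`
makes `D ∂_n² A` free of `p_{2n-1}`.

Altogether `E L = p_{2n} φ_n + n p_{2n-1} D φ_n + (order 2n - 2)` (`eulerLagrange_lagrangian`).
Comparing the coefficients of `p_{2n}` in the equation yields `ρ = φ_n`, which is `e^{-R}` for
`R = - log ρ`, and then the equation is equivalent to the formula for `f` (`multiplier_eq_iff`),
which is affine in `p_{2n-1}`.

Smoothness of the primitives is differentiation under the integral sign (`contDiff_primitive`).
-/

namespace MultiplierProblem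

/-! ### Smooth dependence of integrals on parameters -/

/-- Differentiation under the integral sign: on `[0, 1]` the derivative of a smooth integrand is
bounded, uniformly for parameters in a compact ball. -/
theorem contDiff_intervalIntegral_nat {H : Type} [NormedAddCommGroup H] [NormedSpace ℝ H]
    [FiniteDimensional ℝ H] (n : ℕ) {E : Type} [NormedAddCommGroup E] [NormedSpace ℝ E]
    {G : H × ℝ → E} (hG : ContDiff ℝ ∞ G) :
    ContDiff ℝ n fun x => ∫ t in (0 : ℝ)..1, G (x, t) := by
  induction n generalizing E with
  | zero =>
    exact contDiff_zero.2
      (intervalIntegral.continuous_parametric_intervalIntegral_of_continuous'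
        (by exact hG.continuous) 0 1)
  | succ n ih =>
    have hG' : ContDiff ℝ ∞ fun y : H × ℝ =>
        (fderiv ℝ G y).comp (ContinuousLinearMap.inl ℝ H ℝ) :=
      (hG.fderiv_right (m := ∞) (by simp)).clm_comp contDiff_const
    have key (x₀ : H) : HasFDerivAt (fun x => ∫ t in (0 : ℝ)..1, G (x, t))
        (∫ t in (0 : ℝ)..1, (fderiv ℝ G (x₀, t)).comp (ContinuousLinearMap.inl ℝ H ℝ)) x₀ := by
      have : ProperSpace H := FiniteDimensional.proper_real H
      obtain ⟨C, hC⟩ := ((isCompact_closedBall x₀ 1).prod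
        (isCompact_Icc (a := (0 : ℝ)) (b := 1))).exists_bound_of_continuousOn
        hG'.continuous.continuousOn
      refine intervalIntegral.hasFDerivAt_integral_of_dominated_of_fderiv_le
        (F := fun x t => G (x, t))
        (F' := fun x t => (fderiv ℝ G (x, t)).comp (ContinuousLinearMap.inl ℝ H ℝ))
        (bound := fun _ => C) (Metric.closedBall_mem_nhds x₀ one_pos) ?_ ?_ ?_ ?_ ?_ ?_
      · exact Filter.Eventually.of_forall fun x =>
          (hG.continuous.comp (by fun_prop : Continuous fun t : ℝ => (x, t))).aestronglyMeasurable
      · exact (hG.continuous.comp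
          (by fun_prop : Continuous fun t : ℝ => (x₀, t))).intervalIntegrable _ _
      · exact (hG'.continuous.comp
          (by fun_prop : Continuous fun t : ℝ => (x₀, t))).aestronglyMeasurable
      · refine Filter.Eventually.of_forall fun t ht x hx => hC (x, t) ⟨hx, ?_⟩
        rw [Set.uIoc_of_le zero_le_one] at ht
        exact Set.Ioc_subset_Icc_self ht
      · exact intervalIntegrable_const
      · refine Filter.Eventually.of_forall fun t _ x _ => ?_
        have h := ((hG.differentiable (by simp)) (x, t)).hasFDerivAt
        exact h.comp x (hasFDerivAt_prodMk_left x t)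
    rw [Nat.cast_add, Nat.cast_one, contDiff_succ_iff_fderiv]
    refine ⟨fun x => (key x).differentiableAt, by simp, ?_⟩
    have : fderiv ℝ (fun x => ∫ t in (0 : ℝ)..1, G (x, t)) = fun x => ∫ t in (0 : ℝ)..1,
        (fderiv ℝ G (x, t)).comp (ContinuousLinearMap.inl ℝ H ℝ) :=
      funext fun x => (key x).fderiv
    rw [this]
    exact ih hG'

/-- A primitive with smooth integrand and smooth upper limit is smooth in the parameters:
rescaling the variable of integration makes the interval constant. -/
theorem contDiff_primitive {H : Type} [NormedAddCommGroup H] [NormedSpace ℝ H]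
    [FiniteDimensional ℝ H] {G : H × ℝ → ℝ} (hG : ContDiff ℝ ∞ G) {b : H → ℝ}
    (hb : ContDiff ℝ ∞ b) : ContDiff ℝ ∞ fun x => ∫ t in (0 : ℝ)..b x, G (x, t) := by
  have h : (fun x => ∫ t in (0 : ℝ)..b x, G (x, t)) =
      fun x => b x * ∫ t in (0 : ℝ)..1, G (x, b x * t) := by
    funext x
    have := intervalIntegral.smul_integral_comp_mul_left (a := 0) (b := 1)
      (fun t => G (x, t)) (b x)
    simpa using this.symm
  rw [h]
  refine hb.mul (contDiff_infty.2 fun n => contDiff_intervalIntegral_nat n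
    (G := fun y : H × ℝ => G (y.1, b y.1 * y.2)) ?_)
  exact hG.comp (contDiff_fst.prodMk ((hb.comp contDiff_fst).mul contDiff_snd))

/-! ### Functions of finite order and their partial derivatives -/

/-- The variables `x, p₀, …, p_m` of a point. -/
def trunc (m : ℕ) (z : Jet) : ℝ × (Fin (m + 1) → ℝ) := (z.1, fun i => z.2 i)

/-- `g` expresses `F` as a smooth function of `x, p₀, …, p_m`. -/
def Represents (m : ℕ) (g : ℝ × (Fin (m + 1) → ℝ) → ℝ) (F : Jet → ℝ) : Prop :=
  ContDiff ℝ ∞ g ∧ ∀ z, F z = g (trunc m z)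

theorem SmoothOfOrder.exists_represents {m : ℕ} {F : Jet → ℝ} (hF : SmoothOfOrder m F) :
    ∃ g, Represents m g F :=
  let ⟨g, hg, h⟩ := hF
  ⟨g, hg, fun z => h z.1 z.2⟩

theorem Represents.smooth {m : ℕ} {g} {F : Jet → ℝ} (h : Represents m g F) :
    SmoothOfOrder m F :=
  ⟨g, h.1, fun x p => h.2 (x, p)⟩

/-- The derivative of `F` along a line whose truncation has direction `v`. -/
theorem Represents.hasDerivAt {m : ℕ} {g} {F : Jet → ℝ} (h : Represents m g F)
    {c : ℝ → Jet} {a : ℝ} {v : Jet}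
    (hc : ∀ t, trunc m (c t) = trunc m (c a) + (t - a) • trunc m v) :
    HasDerivAt (fun t => F (c t)) (fderiv ℝ g (trunc m (c a)) (trunc m v)) a := by
  have e : (fun t => F (c t)) = fun t => g (trunc m (c a) + (t - a) • trunc m v) := by
    funext t; rw [h.2, hc t]
  rw [e]
  have h1 : HasDerivAt (fun t : ℝ => trunc m (c a) + (t - a) • trunc m v) (trunc m v) a := by
    simpa using (((hasDerivAt_id a).sub_const a).smul_const (trunc m v)).const_add (trunc m (c a))
  have h2 : HasFDerivAt g (fderiv ℝ g (trunc m (c a)))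
      (trunc m (c a) + (a - a) • trunc m v) := by
    simpa using ((h.1.differentiable (by simp)) (trunc m (c a))).hasFDerivAt
  exact h2.comp_hasDerivAt a h1

theorem Represents.hasDerivAt_x {m : ℕ} {g} {F : Jet → ℝ} (h : Represents m g F) (z : Jet) :
    HasDerivAt (fun t => F (t, z.2)) (fderiv ℝ g (trunc m z) (trunc m (1, 0))) z.1 := by
  refine h.hasDerivAt (c := fun t => (t, z.2)) fun t => ?_
  ext <;> simp [trunc]

theorem Represents.hasDerivAt_p {m : ℕ} {g} {F : Jet → ℝ} (h : Represents m g F) (k : ℕ)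
    (z : Jet) : HasDerivAt (fun t => F (z.1, Function.update z.2 k t))
      (fderiv ℝ g (trunc m z) (trunc m (0, Pi.single k 1))) (z.2 k) := by
  have := h.hasDerivAt (c := fun t => (z.1, Function.update z.2 k t)) (a := z.2 k)
    (v := (0, Pi.single k 1)) fun t => by
      ext i
      · simp [trunc]
      · by_cases hi : (i : ℕ) = k
        · simp [trunc, Function.update_apply, Pi.single_apply, hi]
        · simp [trunc, Function.update_apply, Pi.single_apply, hi]
  simpa using this

theorem contDiff_fderiv_apply {m : ℕ} {g : ℝ × (Fin (m + 1) → ℝ) → ℝ} (hg : ContDiff ℝ ∞ g)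
    (v : ℝ × (Fin (m + 1) → ℝ)) : ContDiff ℝ ∞ fun w => fderiv ℝ g w v :=
  (hg.fderiv_right (m := ∞) (by simp)).clm_apply contDiff_const

theorem Represents.partialX {m : ℕ} {g} {F : Jet → ℝ} (h : Represents m g F) :
    Represents m (fun w => fderiv ℝ g w (trunc m (1, 0))) (partialX F) :=
  ⟨contDiff_fderiv_apply h.1 _, fun z => (h.hasDerivAt_x z).deriv⟩

theorem Represents.partialP {m : ℕ} {g} {F : Jet → ℝ} (h : Represents m g F) (k : ℕ) :
    Represents m (fun w => fderiv ℝ g w (trunc m (0, Pi.single k 1))) (partialP k F) :=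
  ⟨contDiff_fderiv_apply h.1 _, fun z => (h.hasDerivAt_p k z).deriv⟩

theorem SmoothOfOrder.partialX {m : ℕ} {F : Jet → ℝ} (hF : SmoothOfOrder m F) :
    SmoothOfOrder m (partialX F) :=
  let ⟨_, hg⟩ := hF.exists_represents
  hg.partialX.smooth

theorem SmoothOfOrder.partialP {m : ℕ} {F : Jet → ℝ} (hF : SmoothOfOrder m F) (k : ℕ) :
    SmoothOfOrder m (partialP k F) :=
  let ⟨_, hg⟩ := hF.exists_represents
  (hg.partialP k).smooth

theorem SmoothOfOrder.hasDerivAt_x {m : ℕ} {F : Jet → ℝ} (hF : SmoothOfOrder m F) (z : Jet) :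
    HasDerivAt (fun t => F (t, z.2)) (MultiplierProblem.partialX F z) z.1 :=
  let ⟨_, hg⟩ := hF.exists_represents
  (hg.hasDerivAt_x z).differentiableAt.hasDerivAt

theorem SmoothOfOrder.hasDerivAt_p {m : ℕ} {F : Jet → ℝ} (hF : SmoothOfOrder m F) (k : ℕ)
    (z : Jet) : HasDerivAt (fun t => F (z.1, Function.update z.2 k t))
      (MultiplierProblem.partialP k F z) (z.2 k) :=
  let ⟨_, hg⟩ := hF.exists_represents
  (hg.hasDerivAt_p k z).differentiableAt.hasDerivAt

/-- Symmetry of the second derivative. -/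
theorem fderiv_fderiv_apply {m : ℕ} {g : ℝ × (Fin (m + 1) → ℝ) → ℝ} (hg : ContDiff ℝ ∞ g)
    (u v w : ℝ × (Fin (m + 1) → ℝ)) :
    fderiv ℝ (fun y => fderiv ℝ g y u) w v = fderiv ℝ (fun y => fderiv ℝ g y v) w u := by
  have hd : DifferentiableAt ℝ (fderiv ℝ g) w :=
    (hg.fderiv_right (m := ∞) (by simp)).differentiable (by simp) w
  have h (a : ℝ × (Fin (m + 1) → ℝ)) (b : ℝ × (Fin (m + 1) → ℝ)) :
      fderiv ℝ (fun y => fderiv ℝ g y a) w b = fderiv ℝ (fderiv ℝ g) w b a := by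
    rw [fderiv_clm_apply hd (by fun_prop)]
    simp
  rw [h, h]
  exact ((contDiff_infty.1 hg 2).contDiffAt.isSymmSndFDerivAt (by simp)) v u

theorem SmoothOfOrder.partialP_comm {m : ℕ} {F : Jet → ℝ} (hF : SmoothOfOrder m F) (j k : ℕ) :
    MultiplierProblem.partialP j (MultiplierProblem.partialP k F) =
      MultiplierProblem.partialP k (MultiplierProblem.partialP j F) := by
  obtain ⟨g, hg⟩ := hF.exists_represents
  funext z
  rw [((hg.partialP k).partialP j).2, ((hg.partialP j).partialP k).2]
  exact fderiv_fderiv_apply hg.1 _ _ _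

theorem SmoothOfOrder.partialP_partialX {m : ℕ} {F : Jet → ℝ} (hF : SmoothOfOrder m F) (k : ℕ) :
    MultiplierProblem.partialP k (MultiplierProblem.partialX F) =
      MultiplierProblem.partialX (MultiplierProblem.partialP k F) := by
  obtain ⟨g, hg⟩ := hF.exists_represents
  funext z
  rw [(hg.partialX.partialP k).2, ((hg.partialP k).partialX).2]
  exact fderiv_fderiv_apply hg.1 _ _ _

theorem SmoothOfOrder.partialP_eq_zero {m k : ℕ} {F : Jet → ℝ} (hF : SmoothOfOrder m F)
    (hk : m < k) : MultiplierProblem.partialP k F = 0 := by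
  obtain ⟨g, hg⟩ := hF.exists_represents
  funext z
  have : trunc m (0, Pi.single k 1) = 0 := by
    ext i
    · rfl
    · have : (i : ℕ) ≠ k := by omega
      simp [trunc, Pi.single_apply, this]
  rw [(hg.partialP k).2, this]
  simp

theorem SmoothOfOrder.mono {m m' : ℕ} {F : Jet → ℝ} (hF : SmoothOfOrder m F) (h : m ≤ m') :
    SmoothOfOrder m' F := by
  obtain ⟨g, hg, e⟩ := hF
  refine ⟨fun w => g (w.1, fun i => w.2 (Fin.castLE (by omega) i)), ?_, fun x p => e x p⟩
  exact hg.comp (by fun_prop)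

theorem SmoothOfOrder.add {m : ℕ} {F G : Jet → ℝ} (hF : SmoothOfOrder m F)
    (hG : SmoothOfOrder m G) : SmoothOfOrder m (F + G) := by
  obtain ⟨f, hf, ef⟩ := hF
  obtain ⟨g, hg, eg⟩ := hG
  exact ⟨_, hf.add hg, fun x p => by simp [ef, eg]⟩

theorem SmoothOfOrder.mul {m : ℕ} {F G : Jet → ℝ} (hF : SmoothOfOrder m F)
    (hG : SmoothOfOrder m G) : SmoothOfOrder m (F * G) := by
  obtain ⟨f, hf, ef⟩ := hF
  obtain ⟨g, hg, eg⟩ := hG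
  exact ⟨_, hf.mul hg, fun x p => by simp [ef, eg]⟩

theorem SmoothOfOrder.const (m : ℕ) (c : ℝ) : SmoothOfOrder m fun _ => c :=
  ⟨fun _ => c, contDiff_const, fun _ _ => rfl⟩

theorem SmoothOfOrder.const_smul {m : ℕ} {F : Jet → ℝ} (hF : SmoothOfOrder m F) (c : ℝ) :
    SmoothOfOrder m (c • F) :=
  (SmoothOfOrder.const m c).mul hF

theorem SmoothOfOrder.neg {m : ℕ} {F : Jet → ℝ} (hF : SmoothOfOrder m F) :
    SmoothOfOrder m (-F) := by
  simpa using hF.const_smul (-1)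

theorem SmoothOfOrder.sub {m : ℕ} {F G : Jet → ℝ} (hF : SmoothOfOrder m F)
    (hG : SmoothOfOrder m G) : SmoothOfOrder m (F - G) := by
  simpa [sub_eq_add_neg] using hF.add hG.neg

theorem SmoothOfOrder.sum {ι : Type*} {m : ℕ} {F : ι → Jet → ℝ} {s : Finset ι}
    (h : ∀ i ∈ s, SmoothOfOrder m (F i)) : SmoothOfOrder m (∑ i ∈ s, F i) := by
  classical
  induction s using Finset.induction_on with
  | empty => exact SmoothOfOrder.const m 0
  | insert a s ha ih =>
    rw [Finset.sum_insert ha]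
    exact (h a (by simp)).add (ih fun i hi => h i (by simp [hi]))

/-- The coordinate function `p_k`. -/
def coord (k : ℕ) : Jet → ℝ := fun z => z.2 k

theorem SmoothOfOrder.coord {k m : ℕ} (h : k ≤ m) : SmoothOfOrder m (coord k) :=
  ⟨fun w => w.2 ⟨k, by omega⟩, by fun_prop, fun _ _ => rfl⟩

theorem SmoothOfOrder.exp {m : ℕ} {F : Jet → ℝ} (hF : SmoothOfOrder m F) :
    SmoothOfOrder m fun z => Real.exp (F z) := by
  obtain ⟨f, hf, ef⟩ := hF
  exact ⟨_, hf.exp, fun x p => by simp [ef]⟩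

theorem trunc_surjective (m : ℕ) : Function.Surjective (trunc m) := fun w =>
  ⟨(w.1, fun k => if h : k < m + 1 then w.2 ⟨k, h⟩ else 0), by
    ext i
    · rfl
    · simp [trunc, Nat.not_lt.mpr (Nat.le_of_lt_succ i.isLt)]⟩

theorem SmoothOfOrder.log {m : ℕ} {F : Jet → ℝ} (hF : SmoothOfOrder m F) (h : ∀ z, F z ≠ 0) :
    SmoothOfOrder m fun z => Real.log (F z) := by
  obtain ⟨g, hg⟩ := hF.exists_represents
  refine ⟨fun w => Real.log (g w), hg.1.log fun w => ?_, fun x p => congrArg Real.log (hg.2 (x, p))⟩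
  obtain ⟨z, rfl⟩ := trunc_surjective m w
  rw [← hg.2]
  exact h z

/-- Setting `p_m = 0` removes the dependence on `p_m`. -/
theorem SmoothOfOrder.restrict {m : ℕ} {F : Jet → ℝ} (hF : SmoothOfOrder (m + 1) F) :
    SmoothOfOrder m fun z => F (z.1, Function.update z.2 (m + 1) 0) := by
  obtain ⟨g, hg, e⟩ := hF
  refine ⟨fun w => g (w.1, fun i => if h : (i : ℕ) < m + 1 then w.2 ⟨i, h⟩ else 0), ?_,
    fun x p => ?_⟩
  · refine hg.comp (contDiff_fst.prodMk (contDiff_pi.2 fun i => ?_))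
    split_ifs
    · fun_prop
    · exact contDiff_const
  · refine (e _ _).trans ?_
    congr 2
    funext i
    by_cases h : (i : ℕ) < m + 1
    · simp [h, h.ne]
    · have : (i : ℕ) = m + 1 := by omega
      simp [this]

theorem SmoothOfOrder.update {m : ℕ} {F : Jet → ℝ} (hF : SmoothOfOrder m F) (k : ℕ) (c : ℝ) :
    SmoothOfOrder m fun z => F (z.1, Function.update z.2 k c) := by
  obtain ⟨g, hg, e⟩ := hF
  refine ⟨fun w => g (w.1, fun i => if (i : ℕ) = k then c else w.2 i), ?_, fun x p => ?_⟩
  · refine hg.comp (contDiff_fst.prodMk (contDiff_pi.2 fun i => ?_))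
    split_ifs
    · exact contDiff_const
    · fun_prop
  · refine (e _ _).trans ?_
    congr 2
    funext i
    simp [Function.update_apply]

theorem SmoothOfOrder.antiP {m k : ℕ} {F : Jet → ℝ} (hF : SmoothOfOrder m F) (h : k ≤ m) :
    SmoothOfOrder m (antiP k F) := by
  obtain ⟨g, hg, e⟩ := hF
  have hG : ContDiff ℝ ∞ fun y : (ℝ × (Fin (m + 1) → ℝ)) × ℝ =>
      g (y.1.1, fun i => if (i : ℕ) = k then y.2 else y.1.2 i) := by
    refine hg.comp ((by fun_prop : ContDiff ℝ ∞ fun y : (ℝ × (Fin (m + 1) → ℝ)) × ℝ =>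
      y.1.1).prodMk (contDiff_pi.2 fun i => ?_))
    split_ifs <;> fun_prop
  refine ⟨_, contDiff_primitive hG (b := fun w => w.2 ⟨k, by omega⟩) (by fun_prop), fun x p => ?_⟩
  simp only [MultiplierProblem.antiP, e]
  congr 1
  funext t
  congr 2
  funext i
  simp [Function.update_apply]

theorem SmoothOfOrder.antiX {m : ℕ} {F : Jet → ℝ} (hF : SmoothOfOrder m F) :
    SmoothOfOrder m fun z => ∫ t in (0 : ℝ)..z.1, F (t, z.2) := by
  obtain ⟨g, hg, e⟩ := hF
  have hG : ContDiff ℝ ∞ fun y : (ℝ × (Fin (m + 1) → ℝ)) × ℝ => g (y.2, y.1.2) :=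
    hg.comp (by fun_prop)
  exact ⟨_, contDiff_primitive hG (b := fun w => w.1) (by fun_prop), fun x p => by simp only [e]⟩

theorem antiP₂_eq (k : ℕ) (F : Jet → ℝ) : antiP₂ k F = antiP k (antiP k F) := by
  funext z
  simp [antiP₂, antiP]

theorem SmoothOfOrder.antiP₂ {m k : ℕ} {F : Jet → ℝ} (hF : SmoothOfOrder m F) (h : k ≤ m) :
    SmoothOfOrder m (antiP₂ k F) := by
  rw [antiP₂_eq]
  exact (hF.antiP h).antiP h

theorem SmoothOfOrder.continuous_p {m : ℕ} {F : Jet → ℝ} (hF : SmoothOfOrder m F) (k : ℕ)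
    (z : Jet) : Continuous fun t => F (z.1, Function.update z.2 k t) := by
  refine continuous_iff_continuousAt.2 fun t => ?_
  have := hF.hasDerivAt_p k (z.1, Function.update z.2 k t)
  simpa using this.continuousAt

theorem SmoothOfOrder.continuous_x {m : ℕ} {F : Jet → ℝ} (hF : SmoothOfOrder m F) (z : Jet) :
    Continuous fun t => F (t, z.2) :=
  continuous_iff_continuousAt.2 fun t => (hF.hasDerivAt_x (t, z.2)).continuousAt

theorem SmoothOfOrder.partialP_antiP {m k : ℕ} {F : Jet → ℝ} (hF : SmoothOfOrder m F) :
    MultiplierProblem.partialP k (MultiplierProblem.antiP k F) = F := by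
  funext z
  have h := (hF.continuous_p k z).deriv_integral _ 0 (z.2 k)
  simpa [MultiplierProblem.partialP, MultiplierProblem.antiP] using h

theorem SmoothOfOrder.partialX_antiX {m : ℕ} {F : Jet → ℝ} (hF : SmoothOfOrder m F) :
    MultiplierProblem.partialX (fun z => ∫ t in (0 : ℝ)..z.1, F (t, z.2)) = F := by
  funext z
  exact (hF.continuous_x z).deriv_integral _ 0 z.1

/-- The fundamental theorem of calculus in the variable `p_k`. -/
theorem SmoothOfOrder.eq_add_antiP {m : ℕ} {F : Jet → ℝ} (hF : SmoothOfOrder m F) (k : ℕ)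
    (z : Jet) : F z = F (z.1, Function.update z.2 k 0) +
      MultiplierProblem.antiP k (MultiplierProblem.partialP k F) z := by
  have h := intervalIntegral.integral_eq_sub_of_hasDerivAt (a := 0) (b := z.2 k)
    (f := fun t => F (z.1, Function.update z.2 k t))
    (f' := fun t => MultiplierProblem.partialP k F (z.1, Function.update z.2 k t))
    (fun t _ => by simpa using hF.hasDerivAt_p k (z.1, Function.update z.2 k t))
    (((hF.partialP k).continuous_p k z).intervalIntegrable _ _)
  rw [MultiplierProblem.antiP, h]
  simp

/-! ### Rules of differentiation -/

section Rules

variable {m m' : ℕ} {F G : Jet → ℝ}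

theorem partialX_add (hF : SmoothOfOrder m F) (hG : SmoothOfOrder m' G) :
    partialX (F + G) = partialX F + partialX G :=
  funext fun z => ((hF.hasDerivAt_x z).add (hG.hasDerivAt_x z)).deriv

theorem partialP_add (k : ℕ) (hF : SmoothOfOrder m F) (hG : SmoothOfOrder m' G) :
    partialP k (F + G) = partialP k F + partialP k G :=
  funext fun z => ((hF.hasDerivAt_p k z).add (hG.hasDerivAt_p k z)).deriv

theorem partialX_mul (hF : SmoothOfOrder m F) (hG : SmoothOfOrder m' G) :
    partialX (F * G) = partialX F * G + F * partialX G :=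
  funext fun z => ((hF.hasDerivAt_x z).mul (hG.hasDerivAt_x z)).deriv

theorem partialP_mul (k : ℕ) (hF : SmoothOfOrder m F) (hG : SmoothOfOrder m' G) :
    partialP k (F * G) = partialP k F * G + F * partialP k G :=
  funext fun z => by
    have h := ((hF.hasDerivAt_p k z).mul (hG.hasDerivAt_p k z)).deriv
    simp only [Function.update_eq_self] at h
    exact h

theorem partialX_exp (hF : SmoothOfOrder m F) :
    partialX (fun z => Real.exp (F z)) = fun z => Real.exp (F z) * partialX F z :=
  funext fun z => (hF.hasDerivAt_x z).exp.deriv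

theorem partialP_exp (k : ℕ) (hF : SmoothOfOrder m F) :
    partialP k (fun z => Real.exp (F z)) = fun z => Real.exp (F z) * partialP k F z :=
  funext fun z => by
    have h := (hF.hasDerivAt_p k z).exp.deriv
    simp only [Function.update_eq_self] at h
    exact h

theorem partialX_const_smul (c : ℝ) (F : Jet → ℝ) : partialX (c • F) = c • partialX F :=
  funext fun _ => deriv_const_mul_field c

theorem partialP_const_smul (k : ℕ) (c : ℝ) (F : Jet → ℝ) :
    partialP k (c • F) = c • partialP k F :=
  funext fun _ => deriv_const_mul_field c

theorem partialX_coord (j : ℕ) : partialX (coord j) = 0 :=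
  funext fun _ => deriv_const _ _

theorem partialP_coord (k j : ℕ) : partialP k (coord j) = if j = k then 1 else 0 := by
  funext z
  by_cases h : j = k
  · simp [partialP, coord, h]
  · simp [partialP, coord, h]

end Rules

/-! ### The truncated total derivatives -/

section TotalD

variable {m m' M M' k : ℕ} {F G : Jet → ℝ}

theorem totalD_eq (M : ℕ) (F : Jet → ℝ) :
    totalD M F = partialX F + ∑ k ∈ Finset.range M, coord (k + 1) * partialP k F := by
  funext z
  simp [totalD, coord]

theorem totalD_zero (F : Jet → ℝ) : totalD 0 F = partialX F := by
  simp [totalD_eq]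

theorem totalD_succ (M : ℕ) (F : Jet → ℝ) :
    totalD (M + 1) F = totalD M F + coord (M + 1) * partialP M F := by
  rw [totalD_eq, totalD_eq, Finset.sum_range_succ, add_assoc]

theorem totalD_add (M : ℕ) (hF : SmoothOfOrder m F) (hG : SmoothOfOrder m' G) :
    totalD M (F + G) = totalD M F + totalD M G := by
  induction M with
  | zero => simp only [totalD_zero, partialX_add hF hG]
  | succ M ih => rw [totalD_succ, totalD_succ, totalD_succ, ih, partialP_add M hF hG]; ring

theorem totalD_const_smul (M : ℕ) (c : ℝ) (F : Jet → ℝ) :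
    totalD M (c • F) = c • totalD M F := by
  induction M with
  | zero => simp only [totalD_zero, partialX_const_smul]
  | succ M ih =>
    rw [totalD_succ, totalD_succ, ih, partialP_const_smul, smul_add, mul_smul_comm]

theorem totalD_mul (M : ℕ) (hF : SmoothOfOrder m F) (hG : SmoothOfOrder m' G) :
    totalD M (F * G) = totalD M F * G + F * totalD M G := by
  induction M with
  | zero => simp only [totalD_zero, partialX_mul hF hG]
  | succ M ih => rw [totalD_succ, totalD_succ, totalD_succ, ih, partialP_mul M hF hG]; ring

theorem totalD_exp (M : ℕ) (hF : SmoothOfOrder m F) :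
    totalD M (fun z => Real.exp (F z)) = (fun z => Real.exp (F z)) * totalD M F := by
  induction M with
  | zero => rw [totalD_zero, totalD_zero, partialX_exp hF]; rfl
  | succ M ih =>
    rw [totalD_succ, totalD_succ, ih, partialP_exp M hF]
    funext z
    simp only [Pi.add_apply, Pi.mul_apply]
    ring

theorem totalD_coord (h : k < M) : totalD M (coord k) = coord (k + 1) := by
  rw [totalD_eq, partialX_coord, zero_add, Finset.sum_eq_single k]
  · simp [partialP_coord]
  · intro b _ hb
    simp [partialP_coord, hb.symm]
  · simp [h]

theorem totalD_zero_right (M : ℕ) : totalD M 0 = 0 := by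
  simpa using totalD_const_smul M 0 0

theorem totalD_iterate_zero (M k : ℕ) : (totalD M)^[k] 0 = 0 :=
  Function.iterate_fixed (totalD_zero_right M) k

theorem SmoothOfOrder.totalD_of_le (hF : SmoothOfOrder m F) (hm : m ≤ m')
    (h : ∀ k < M, k ≤ m → k < m') : SmoothOfOrder m' (totalD M F) := by
  rw [totalD_eq]
  refine (hF.partialX.mono hm).add (SmoothOfOrder.sum fun k hk => ?_)
  by_cases hkm : k ≤ m
  · exact (SmoothOfOrder.coord (h k (Finset.mem_range.1 hk) hkm)).mul ((hF.partialP k).mono hm)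
  · rw [hF.partialP_eq_zero (not_le.1 hkm), mul_zero]
    exact SmoothOfOrder.const m' 0

theorem SmoothOfOrder.totalD (hF : SmoothOfOrder m F) (M : ℕ) :
    SmoothOfOrder (m + 1) (totalD M F) :=
  hF.totalD_of_le (by omega) (by omega)

/-- Truncation at `M ≤ m` keeps the order `m`. -/
theorem SmoothOfOrder.totalD_self (hF : SmoothOfOrder m F) (h : M ≤ m) :
    SmoothOfOrder m (MultiplierProblem.totalD M F) :=
  hF.totalD_of_le le_rfl (by omega)

theorem SmoothOfOrder.totalD_iterate (hF : SmoothOfOrder m F) (M k : ℕ) :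
    SmoothOfOrder (m + k) ((MultiplierProblem.totalD M)^[k] F) := by
  induction k with
  | zero => exact hF
  | succ k ih =>
    rw [Function.iterate_succ_apply']
    exact ih.totalD M

theorem SmoothOfOrder.totalD_iterate_self (hF : SmoothOfOrder m F) (h : M ≤ m) (k : ℕ) :
    SmoothOfOrder m ((MultiplierProblem.totalD M)^[k] F) := by
  induction k with
  | zero => exact hF
  | succ k ih =>
    rw [Function.iterate_succ_apply']
    exact ih.totalD_self h

/-- On functions of order less than `M`, the operator `D_M` is the full total derivative. -/
theorem totalD_congr (hF : SmoothOfOrder m F) (h : m < M) (h' : m < M') :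
    totalD M F = totalD M' F := by
  have key (j : ℕ) : totalD (m + 1 + j) F = totalD (m + 1) F := by
    induction j with
    | zero => rfl
    | succ j ih =>
      rw [← add_assoc, totalD_succ, ih, hF.partialP_eq_zero (by omega), mul_zero, add_zero]
  obtain ⟨j, rfl⟩ := Nat.exists_eq_add_of_lt h
  obtain ⟨j', rfl⟩ := Nat.exists_eq_add_of_lt h'
  rw [add_right_comm, key, add_right_comm m j', key]

theorem totalD_iterate_congr (hF : SmoothOfOrder m F) (h : m + k ≤ M) (h' : m + k ≤ M') :
    (totalD M)^[k] F = (totalD M')^[k] F := by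
  induction k with
  | zero => rfl
  | succ k ih =>
    rw [Function.iterate_succ_apply', Function.iterate_succ_apply', ih (by omega) (by omega)]
    exact totalD_congr (hF.totalD_iterate M' k) (by omega) (by omega)

/-- On functions of order `m`, the full total derivative exceeds `D_m` by `p_{m+1} ∂_m`. -/
theorem totalD_eq_add_coord_mul (hF : SmoothOfOrder m F) (h : m < M) :
    totalD M F = totalD m F + coord (m + 1) * partialP m F := by
  rw [totalD_congr hF h (Nat.lt_succ_self m), totalD_succ]

theorem totalD_iterate_add (M k : ℕ) (hF : SmoothOfOrder m F) (hG : SmoothOfOrder m' G) :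
    (totalD M)^[k] (F + G) = (totalD M)^[k] F + (totalD M)^[k] G := by
  induction k with
  | zero => rfl
  | succ k ih =>
    simp only [Function.iterate_succ_apply', ih]
    exact totalD_add M (hF.totalD_iterate M k) (hG.totalD_iterate M k)

theorem totalD_iterate_const_smul (M k : ℕ) (c : ℝ) (F : Jet → ℝ) :
    (totalD M)^[k] (c • F) = c • (totalD M)^[k] F := by
  induction k with
  | zero => rfl
  | succ k ih =>
    simp only [Function.iterate_succ_apply', ih, totalD_const_smul]

/-! ### Commutation with the partial derivatives -/

/-- The induction step for the commutators of `∂_k` with `D_M`. -/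
theorem partialP_totalD_succ (hF : SmoothOfOrder m F) (M k : ℕ) :
    partialP k (totalD (M + 1) F) = partialP k (totalD M F) +
      ((if M + 1 = k then 1 else 0) * partialP M F +
        coord (M + 1) * partialP M (partialP k F)) := by
  rw [totalD_succ, partialP_add k (hF.totalD M)
      ((SmoothOfOrder.coord (le_max_left (M + 1) m)).mul
        ((hF.partialP M).mono (le_max_right (M + 1) m))),
    partialP_mul k (SmoothOfOrder.coord le_rfl) (hF.partialP M), partialP_coord,
    hF.partialP_comm k M]

theorem partialP_zero_totalD (hF : SmoothOfOrder m F) (M : ℕ) :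
    partialP 0 (totalD M F) = totalD M (partialP 0 F) := by
  induction M with
  | zero => simp only [totalD_zero, hF.partialP_partialX]
  | succ M ih =>
    rw [partialP_totalD_succ hF, ih, totalD_succ, if_neg (by omega), zero_mul, zero_add]

theorem partialP_succ_totalD_of_le (hF : SmoothOfOrder m F) (h : M ≤ k) :
    partialP (k + 1) (totalD M F) = totalD M (partialP (k + 1) F) := by
  induction M with
  | zero => simp only [totalD_zero, hF.partialP_partialX]
  | succ M ih =>
    rw [partialP_totalD_succ hF, ih (by omega), totalD_succ, if_neg (by omega), zero_mul, zero_add]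

/-- The commutator `[∂_{k+1}, D_M] = ∂_k` for `k < M`. -/
theorem partialP_succ_totalD (hF : SmoothOfOrder m F) (h : k < M) :
    partialP (k + 1) (totalD M F) = totalD M (partialP (k + 1) F) + partialP k F := by
  induction M with
  | zero => omega
  | succ M ih =>
    rw [partialP_totalD_succ hF, totalD_succ]
    rcases (Nat.lt_succ_iff_lt_or_eq.1 h) with h | rfl
    · rw [ih h, if_neg (by omega)]
      ring
    · rw [partialP_succ_totalD_of_le hF le_rfl, if_pos rfl]
      ring

/-- The derivative of `D^k F` by its highest variable. -/
theorem partialP_totalD_iterate_top (hF : SmoothOfOrder m F) (h : m + k ≤ M) :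
    partialP (m + k) ((totalD M)^[k] F) = partialP m F := by
  induction k with
  | zero => rfl
  | succ k ih =>
    have hk := hF.totalD_iterate M k
    rw [Function.iterate_succ_apply', ← add_assoc, partialP_succ_totalD hk (by omega),
      hk.partialP_eq_zero (by omega), totalD_zero_right, zero_add, ih (by omega)]

/-- The derivative of `D^k F` by its second highest variable. -/
theorem partialP_totalD_iterate_subtop (hF : SmoothOfOrder (m + 1) F) (h : m + 1 + k ≤ M) :
    partialP (m + k) ((totalD M)^[k] F) =
      (k : ℝ) • totalD M (partialP (m + 1) F) + partialP m F := by
  induction k with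
  | zero => simp
  | succ k ih =>
    have hk := hF.totalD_iterate M k
    have htop := partialP_totalD_iterate_top hF (show m + 1 + k ≤ M by omega)
    rw [Function.iterate_succ_apply', ← add_assoc, partialP_succ_totalD hk (by omega),
      ih (by omega), add_right_comm m k 1, htop, Nat.cast_succ, add_smul, one_smul]
    abel

end TotalD

/-! ### The Euler–Lagrange operators -/

section EulerLagrange

variable {m m' M M' n : ℕ} {F G : Jet → ℝ}

theorem eulerLagrange_eq (M n : ℕ) (F : Jet → ℝ) :
    eulerLagrange M n F =
      ∑ k ∈ Finset.range (n + 1), (-1 : ℝ) ^ k • (totalD M)^[k] (partialP k F) := by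
  funext z
  simp [eulerLagrange]

theorem eulerLagrange_succ (M n : ℕ) (F : Jet → ℝ) :
    eulerLagrange M (n + 1) F =
      eulerLagrange M n F + (-1 : ℝ) ^ (n + 1) • (totalD M)^[n + 1] (partialP (n + 1) F) := by
  rw [eulerLagrange_eq, eulerLagrange_eq, Finset.sum_range_succ _ (n + 1)]

theorem eulerLagrange_zero (M : ℕ) (F : Jet → ℝ) : eulerLagrange M 0 F = partialP 0 F := by
  simp [eulerLagrange_eq]

theorem eulerLagrange_add (M n : ℕ) (hF : SmoothOfOrder m F) (hG : SmoothOfOrder m' G) :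
    eulerLagrange M n (F + G) = eulerLagrange M n F + eulerLagrange M n G := by
  simp only [eulerLagrange_eq, ← Finset.sum_add_distrib, ← smul_add]
  refine Finset.sum_congr rfl fun k _ => ?_
  rw [partialP_add k hF hG, totalD_iterate_add M k (hF.partialP k) (hG.partialP k)]

theorem eulerLagrange_const_smul (M n : ℕ) (c : ℝ) (F : Jet → ℝ) :
    eulerLagrange M n (c • F) = c • eulerLagrange M n F := by
  simp only [eulerLagrange_eq, Finset.smul_sum]
  refine Finset.sum_congr rfl fun k _ => ?_
  rw [partialP_const_smul, totalD_iterate_const_smul, smul_comm]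

/-- On functions of order `m`, all Euler–Lagrange operators that see enough variables agree. -/
theorem eulerLagrange_congr (hF : SmoothOfOrder m F) (h : m ≤ n) (hM : m + m ≤ M)
    (hM' : m + m ≤ M') : eulerLagrange M n F = eulerLagrange M' m F := by
  obtain ⟨j, rfl⟩ := Nat.exists_eq_add_of_le h
  have key : eulerLagrange M (m + j) F = eulerLagrange M m F := by
    induction j with
    | zero => rfl
    | succ j ih =>
      rw [← add_assoc, eulerLagrange_succ, ih (by omega), hF.partialP_eq_zero (by omega),
        totalD_iterate_zero, smul_zero, add_zero]
  rw [key, eulerLagrange_eq, eulerLagrange_eq]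
  refine Finset.sum_congr rfl fun k hk => ?_
  have := Finset.mem_range.1 hk
  rw [totalD_iterate_congr (hF.partialP k) (by omega : m + k ≤ M) (by omega : m + k ≤ M')]

theorem SmoothOfOrder.eulerLagrange_of_le (hF : SmoothOfOrder m F) (h : m ≤ M) (n : ℕ) :
    SmoothOfOrder M (eulerLagrange M n F) := by
  rw [eulerLagrange_eq]
  exact SmoothOfOrder.sum fun k _ =>
    ((((hF.partialP k).mono h).totalD_iterate_self le_rfl k).const_smul _)

/-- The Euler–Lagrange sum of a total derivative telescopes to its last term. -/
theorem eulerLagrange_totalD_eq (hF : SmoothOfOrder m F) (h : n ≤ M) :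
    eulerLagrange M n (totalD M F) = (-1 : ℝ) ^ n • (totalD M)^[n + 1] (partialP n F) := by
  induction n with
  | zero =>
    rw [eulerLagrange_zero, partialP_zero_totalD hF]
    simp
  | succ n ih =>
    rw [eulerLagrange_succ, ih (by omega), partialP_succ_totalD hF (by omega),
      totalD_iterate_add M (n + 1) ((hF.partialP (n + 1)).totalD M) (hF.partialP n),
      ← Function.iterate_succ_apply, pow_succ]
    module

/-- Total derivatives are null Lagrangians. -/
theorem eulerLagrange_totalD (hF : SmoothOfOrder m F) (hn : m < n) (h : n ≤ M) :
    eulerLagrange M n (totalD M F) = 0 := by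
  rw [eulerLagrange_totalD_eq hF h, hF.partialP_eq_zero hn, totalD_iterate_zero, smul_zero]

/-- The highest term of `E_{2m+2}^{m+1} A` for `A` of order `m + 1`. -/
theorem eulerLagrange_eq_top (hF : SmoothOfOrder (m + 1) F) :
    eulerLagrange (2 * (m + 1)) (m + 1) F =
      (-1 : ℝ) ^ (m + 1) • (coord (2 * (m + 1)) * partialP (m + 1) (partialP (m + 1) F)) +
        eulerLagrange (2 * (m + 1) - 1) (m + 1) F := by
  have e : 2 * (m + 1) - 1 = m + 1 + m := by omega
  have e' : 2 * (m + 1) = m + 1 + m + 1 := by omega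
  rw [e, e']
  have hB := hF.partialP (m + 1)
  have low : eulerLagrange (m + 1 + m + 1) m F = eulerLagrange (m + 1 + m) m F := by
    rw [eulerLagrange_eq, eulerLagrange_eq]
    refine Finset.sum_congr rfl fun k hk => ?_
    have := Finset.mem_range.1 hk
    rw [totalD_iterate_congr (hF.partialP k) (by omega : m + 1 + k ≤ m + 1 + m + 1)
      (by omega : m + 1 + k ≤ m + 1 + m)]
  rw [eulerLagrange_succ, eulerLagrange_succ, low, Function.iterate_succ_apply',
    Function.iterate_succ_apply',
    totalD_iterate_congr hB (by omega : m + 1 + m ≤ m + 1 + m + 1) (le_refl (m + 1 + m)),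
    totalD_eq_add_coord_mul (hB.totalD_iterate (m + 1 + m) m) (Nat.lt_succ_self _),
    partialP_totalD_iterate_top hB le_rfl, smul_add]
  abel

/-- The two highest terms of `E_{2n}^n A` for `A` of order `n = c + 3`: the terms with
`∂_{n-1} ∂_n A` that come from `D^n ∂_n A` and from `D^{n-1} ∂_{n-1} A` cancel. -/
theorem eulerLagrange_eq_top_two {c : ℕ} (hF : SmoothOfOrder (c + 3) F) :
    eulerLagrange (2 * (c + 3)) (c + 3) F =
      (-1 : ℝ) ^ (c + 3) •
        (coord (2 * (c + 3)) * partialP (c + 3) (partialP (c + 3) F) +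
          ((c + 3 : ℕ) : ℝ) • (coord (2 * (c + 3) - 1) *
            totalD (c + 3 + 1) (partialP (c + 3) (partialP (c + 3) F)))) +
        eulerLagrange (2 * (c + 3) - 2) (c + 3) F := by
  have e2 : 2 * (c + 3) - 2 = c + 3 + (c + 1) := by omega
  have e1 : 2 * (c + 3) - 1 = c + 3 + (c + 1) + 1 := by omega
  have e0 : 2 * (c + 3) = c + 3 + (c + 1) + 2 := by omega
  rw [e2, e1, e0]
  obtain ⟨s, hs⟩ : ∃ s, s = c + 3 + (c + 1) := ⟨_, rfl⟩
  rw [← hs]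
  have hB := hF.partialP (c + 3)
  have hB' := hF.partialP (c + 2)
  have hρ := hB.partialP (c + 3)
  have low : eulerLagrange (s + 2) (c + 1) F = eulerLagrange s (c + 1) F := by
    rw [eulerLagrange_eq, eulerLagrange_eq]
    refine Finset.sum_congr rfl fun k hk => ?_
    have := Finset.mem_range.1 hk
    rw [totalD_iterate_congr (hF.partialP k) (by omega : c + 3 + k ≤ s + 2)
      (by omega : c + 3 + k ≤ s)]
  -- `s = 2n - 2`; with `c + 1` factors `D` no truncation occurs, and the factor `c + 2` adds one
  -- term in `p_{2n-1}`
  have step {B : Jet → ℝ} (hB : SmoothOfOrder (c + 3) B) : (totalD (s + 2))^[c + 2] B =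
      (totalD s)^[c + 2] B + coord (s + 1) * partialP (c + 3) B := by
    have hH := hB.totalD_iterate s (c + 1)
    rw [← hs] at hH
    rw [Function.iterate_succ_apply' _ (c + 1), Function.iterate_succ_apply' _ (c + 1),
      totalD_iterate_congr hB (by omega : c + 3 + (c + 1) ≤ s + 2) (le_of_eq hs.symm),
      totalD_eq_add_coord_mul hH (by omega)]
    congr 2
    have := partialP_totalD_iterate_top hB (le_of_eq hs.symm)
    rwa [← hs] at this
  have hH := hB.totalD_iterate s (c + 1)
  rw [← hs] at hH
  have hG : SmoothOfOrder s ((totalD s)^[c + 2] (partialP (c + 3) F)) := by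
    rw [Function.iterate_succ_apply']
    exact hH.totalD_self le_rfl
  have hDρ : totalD s (partialP (c + 3) (partialP (c + 3) F)) =
      totalD (c + 3 + 1) (partialP (c + 3) (partialP (c + 3) F)) :=
    totalD_congr hρ (by omega) (by omega)
  have hDρ' : totalD (s + 2) (partialP (c + 3) (partialP (c + 3) F)) =
      totalD (c + 3 + 1) (partialP (c + 3) (partialP (c + 3) F)) :=
    totalD_congr hρ (by omega) (by omega)
  have top : partialP s ((totalD s)^[c + 1] (partialP (c + 3) F)) =
      partialP (c + 3) (partialP (c + 3) F) := by
    have := partialP_totalD_iterate_top hB (le_of_eq hs.symm)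
    rwa [← hs] at this
  have subtop : partialP s ((totalD s)^[c + 2] (partialP (c + 3) F)) =
      ((c + 2 : ℕ) : ℝ) • totalD (c + 3 + 1) (partialP (c + 3) (partialP (c + 3) F)) +
        partialP (c + 2) (partialP (c + 3) F) := by
    obtain ⟨s', rfl⟩ : ∃ s', s = s' + 1 := ⟨c + 2 + (c + 1), by omega⟩
    have h := partialP_totalD_iterate_subtop (M := s' + 1) (k := c + 1) hB (by omega)
    rw [show c + 2 + (c + 1) = s' by omega] at h
    rw [Function.iterate_succ_apply', partialP_succ_totalD hH (Nat.lt_succ_self s'), top, h, hDρ]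
    push_cast
    module
  rw [eulerLagrange_succ, eulerLagrange_succ, eulerLagrange_succ s, eulerLagrange_succ s, low,
    Function.iterate_succ_apply' _ (c + 2),
    Function.iterate_succ_apply' _ (c + 2) (partialP (c + 3) F), step hB, step hB',
    totalD_add (s + 2) hG ((SmoothOfOrder.coord (le_max_left (s + 1) (c + 3))).mul
      (hρ.mono (le_max_right _ _))),
    totalD_mul (s + 2) (SmoothOfOrder.coord le_rfl) hρ, totalD_coord (by omega), hDρ',
    totalD_eq_add_coord_mul hG (by omega), subtop, hF.partialP_comm (c + 3) (c + 2)]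
  funext z
  simp only [Pi.add_apply, Pi.smul_apply, Pi.mul_apply, smul_eq_mul]
  push_cast
  ring

end EulerLagrange

/-! ### Lagrangians modulo total derivatives -/

/-- The Lagrangian with parameters `ρ`, `φ 0, …, φ (n - 1)`, `N`: double primitives of `ρ` and of
the `φ l`, and the null Lagrangian `D_n N`. -/
noncomputable def lagrangian (n : ℕ) (ρ : Jet → ℝ) (φ : ℕ → Jet → ℝ) (N : Jet → ℝ) : Jet → ℝ :=
  (-1 : ℝ) ^ n • antiP₂ n ρ + ∑ l ∈ Finset.Icc 1 (n - 1), (-1 : ℝ) ^ l • antiP₂ l (φ l) +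
    antiP 0 (φ 0) + totalD n N

/-- The part of `E_{2n}^n` of a Lagrangian `lagrangian n ρ φ N` that is free of `p_{2n-1}` and
`p_{2n}`. -/
noncomputable def lowerPart (n : ℕ) (ρ : Jet → ℝ) (φ : ℕ → Jet → ℝ) : Jet → ℝ :=
  (-1 : ℝ) ^ n • eulerLagrange (2 * n - 2) n (antiP₂ n ρ) +
    ∑ l ∈ Finset.Icc 1 (n - 1),
      (φ l * coord (2 * l) + (-1 : ℝ) ^ l • eulerLagrange (2 * l - 1) l (antiP₂ l (φ l))) + φ 0

section Lagrangian

variable {n : ℕ} {ρ N : Jet → ℝ} {φ : ℕ → Jet → ℝ}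

theorem smoothOfOrder_lagrangian (hρ : SmoothOfOrder n ρ) (hφ : ∀ k < n, SmoothOfOrder k (φ k))
    (hN : SmoothOfOrder (n - 1) N) (hn : 1 ≤ n) : SmoothOfOrder n (lagrangian n ρ φ N) := by
  refine ((((hρ.antiP₂ le_rfl).const_smul _).add (SmoothOfOrder.sum fun l hl => ?_)).add
    (((hφ 0 (by omega)).antiP le_rfl).mono (by omega))).add ((hN.totalD n).mono (by omega))
  have := Finset.mem_Icc.1 hl
  exact (((hφ l (by omega)).antiP₂ le_rfl).const_smul _).mono (by omega)

theorem smoothOfOrder_lowerPart (hρ : SmoothOfOrder n ρ) (hφ : ∀ k < n, SmoothOfOrder k (φ k))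
    (hn : 2 ≤ n) : SmoothOfOrder (2 * n - 2) (lowerPart n ρ φ) := by
  refine (((((hρ.antiP₂ le_rfl).eulerLagrange_of_le (by omega) n).const_smul _).add
    (SmoothOfOrder.sum fun l hl => ?_)).add ((hφ 0 (by omega)).mono (by omega)))
  have := Finset.mem_Icc.1 hl
  have hl := hφ l (by omega)
  exact ((hl.mono (by omega)).mul (SmoothOfOrder.coord (by omega))).add
    ((((hl.antiP₂ le_rfl).eulerLagrange_of_le (by omega) l).mono (by omega)).const_smul _)

theorem partialP_partialP_antiP₂ {m k : ℕ} {F : Jet → ℝ} (hF : SmoothOfOrder m F) (h : k ≤ m) :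
    partialP k (partialP k (antiP₂ k F)) = F := by
  rw [antiP₂_eq, (hF.antiP h).partialP_antiP, hF.partialP_antiP]

theorem eulerLagrange_sum {ι : Type*} {m : ℕ} (M k : ℕ) {s : Finset ι} {F : ι → Jet → ℝ}
    (hF : ∀ i ∈ s, SmoothOfOrder m (F i)) :
    eulerLagrange M k (∑ i ∈ s, F i) = ∑ i ∈ s, eulerLagrange M k (F i) := by
  classical
  induction s using Finset.induction_on with
  | empty => simpa using eulerLagrange_const_smul M k 0 0
  | insert a s ha ih =>
    have hs : ∀ i ∈ s, SmoothOfOrder m (F i) := fun i hi => hF i (by simp [hi])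
    rw [Finset.sum_insert ha, Finset.sum_insert ha,
      eulerLagrange_add M k (hF a (by simp)) (SmoothOfOrder.sum hs), ih hs]

/-- The Euler–Lagrange expression of `lagrangian n ρ φ N`. -/
theorem eulerLagrange_lagrangian (hn : 3 ≤ n) (hρ : SmoothOfOrder n ρ)
    (hφ : ∀ k < n, SmoothOfOrder k (φ k)) (hN : SmoothOfOrder (n - 1) N) :
    eulerLagrange (2 * n) n (lagrangian n ρ φ N) =
      coord (2 * n) * ρ + (n : ℝ) • (coord (2 * n - 1) * totalD (n + 1) ρ) +
        lowerPart n ρ φ := by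
  have hA := (hρ.antiP₂ le_rfl).const_smul ((-1 : ℝ) ^ n)
  have hS : ∀ l ∈ Finset.Icc 1 (n - 1),
      SmoothOfOrder n ((-1 : ℝ) ^ l • antiP₂ l (φ l)) := fun l hl => by
    have := Finset.mem_Icc.1 hl
    exact (((hφ l (by omega)).antiP₂ le_rfl).const_smul _).mono (by omega)
  have h0 := (hφ 0 (by omega)).antiP le_rfl
  have hsq (l : ℕ) (F : Jet → ℝ) : (-1 : ℝ) ^ l • (-1 : ℝ) ^ l • F = F := by
    rw [smul_smul, ← mul_pow]
    simp
  rw [lagrangian, eulerLagrange_add _ _ ((hA.add (SmoothOfOrder.sum hS)).add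
      (h0.mono (by omega : 0 ≤ n))) (hN.totalD n),
    eulerLagrange_add _ _ (hA.add (SmoothOfOrder.sum hS)) h0,
    eulerLagrange_add _ _ hA (SmoothOfOrder.sum hS), eulerLagrange_sum _ _ hS,
    totalD_congr hN (by omega : n - 1 < n) (by omega : n - 1 < 2 * n),
    eulerLagrange_totalD hN (by omega) (by omega),
    eulerLagrange_congr h0 (by omega) (by omega) (le_refl (0 + 0)), eulerLagrange_zero,
    (hφ 0 (by omega)).partialP_antiP, eulerLagrange_const_smul]
  have top : (-1 : ℝ) ^ n • eulerLagrange (2 * n) n (antiP₂ n ρ) =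
      coord (2 * n) * ρ + (n : ℝ) • (coord (2 * n - 1) * totalD (n + 1) ρ) +
        (-1 : ℝ) ^ n • eulerLagrange (2 * n - 2) n (antiP₂ n ρ) := by
    obtain ⟨c, rfl⟩ := Nat.exists_eq_add_of_le' hn
    rw [eulerLagrange_eq_top_two (hρ.antiP₂ le_rfl), partialP_partialP_antiP₂ hρ le_rfl,
      smul_add, hsq]
  have low : ∑ l ∈ Finset.Icc 1 (n - 1), eulerLagrange (2 * n) n ((-1 : ℝ) ^ l • antiP₂ l (φ l)) =
      ∑ l ∈ Finset.Icc 1 (n - 1),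
        (φ l * coord (2 * l) + (-1 : ℝ) ^ l • eulerLagrange (2 * l - 1) l (antiP₂ l (φ l))) := by
    refine Finset.sum_congr rfl fun l hl => ?_
    have hln := Finset.mem_Icc.1 hl
    have hl := hφ l (by omega)
    rw [eulerLagrange_const_smul, eulerLagrange_congr (hl.antiP₂ le_rfl) (by omega) (by omega)
      (by omega : l + l ≤ 2 * l)]
    obtain ⟨j, rfl⟩ := Nat.exists_eq_add_of_le' hln.1
    rw [eulerLagrange_eq_top (hl.antiP₂ le_rfl), partialP_partialP_antiP₂ hl le_rfl,
      smul_add, hsq, mul_comm]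
  rw [top, low, lowerPart]
  abel

end Lagrangian

/-- Taylor's formula of second order in the variable `p_k`. -/
theorem SmoothOfOrder.eq_add_mul_add_antiP₂ {m : ℕ} {F : Jet → ℝ} (hF : SmoothOfOrder m F) {k : ℕ}
    (hk : k ≤ m) (z : Jet) :
    F z = F (z.1, Function.update z.2 k 0) +
      z.2 k * MultiplierProblem.partialP k F (z.1, Function.update z.2 k 0) +
        MultiplierProblem.antiP₂ k
          (MultiplierProblem.partialP k (MultiplierProblem.partialP k F)) z := by
  have hF' := hF.partialP k
  have hA := (hF'.partialP k).antiP hk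
  have e : (fun t => MultiplierProblem.partialP k F (z.1, Function.update z.2 k t)) = fun t =>
      MultiplierProblem.partialP k F (z.1, Function.update z.2 k 0) + MultiplierProblem.antiP k
        (MultiplierProblem.partialP k (MultiplierProblem.partialP k F))
        (z.1, Function.update z.2 k t) := by
    funext t
    simpa only [Function.update_idem] using hF'.eq_add_antiP k (z.1, Function.update z.2 k t)
  rw [hF.eq_add_antiP k z, add_assoc, antiP₂_eq, MultiplierProblem.antiP, e]
  rw [intervalIntegral.integral_add intervalIntegrable_const
    ((hA.continuous_p k z).intervalIntegrable _ _)]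
  rw [intervalIntegral.integral_const, sub_zero, smul_eq_mul]
  rfl

/-- Every Lagrangian of order `m` is a sum of iterated primitives of functions `φ l` of order `l`,
up to a total derivative. By Taylor's formula in `p_m`, what remains after the double primitive is
affine in `p_m`, and its linear term is that of a total derivative; the rest has order `m - 1`. -/
theorem exists_eq_sum_antiP₂ (m : ℕ) {L : Jet → ℝ} (hL : SmoothOfOrder m L) :
    ∃ (φ : ℕ → Jet → ℝ) (N : Jet → ℝ), (∀ k ≤ m, SmoothOfOrder k (φ k)) ∧
      SmoothOfOrder (m - 1) N ∧ ∀ M, m ≤ M →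
        L = ∑ l ∈ Finset.Icc 1 m, (-1 : ℝ) ^ l • antiP₂ l (φ l) + antiP 0 (φ 0) +
          totalD M N := by
  induction m generalizing L with
  | zero =>
    -- a function of `x` alone is the total derivative of its primitive
    have hc := hL.update 0 0
    have hN := hc.antiX
    refine ⟨fun _ => partialP 0 L, _, fun k hk => ?_, hN, fun M _ => ?_⟩
    · exact (hL.partialP 0).mono (Nat.zero_le k)
    · have h0 (k : ℕ) : partialP k (fun z : Jet => ∫ t in (0 : ℝ)..z.1,
          L (t, Function.update z.2 0 0)) = 0 := by
        rcases k with _ | k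
        · funext z
          simp [partialP]
        · exact hN.partialP_eq_zero (Nat.succ_pos k)
      rw [totalD_eq]
      simp only [h0, mul_zero, Finset.sum_const_zero, add_zero]
      rw [hc.partialX_antiX]
      funext z
      rw [hL.eq_add_antiP 0 z]
      simp [add_comm]
  | succ m ih =>
    set b : Jet → ℝ := fun z => partialP (m + 1) L (z.1, Function.update z.2 (m + 1) 0) with hb
    set a : Jet → ℝ := fun z => L (z.1, Function.update z.2 (m + 1) 0) with ha
    have hb' : SmoothOfOrder m b := (hL.partialP (m + 1)).restrict
    have ha' : SmoothOfOrder m a := hL.restrict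
    have hB := hb'.antiP (le_refl m)
    obtain ⟨φ, N, hφ, hN, h⟩ := ih (ha'.sub (hB.totalD_self (le_refl m)))
    have hN' : SmoothOfOrder m N := hN.mono (by omega)
    refine ⟨Function.update φ (m + 1) ((-1 : ℝ) ^ (m + 1) • partialP (m + 1) (partialP (m + 1) L)),
      N + antiP m b, fun k hk => ?_, hN'.add hB, fun M hM => ?_⟩
    · rcases Nat.le_succ_iff.1 hk with hk | rfl
      · rw [Function.update_of_ne (by omega)]
        exact hφ k hk
      · rw [Function.update_self]
        exact ((hL.partialP _).partialP _).const_smul _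
    · have hT : L = a + coord (m + 1) * b +
          antiP₂ (m + 1) (partialP (m + 1) (partialP (m + 1) L)) :=
        funext fun z => hL.eq_add_mul_add_antiP₂ le_rfl z
      have hS : ∑ l ∈ Finset.Icc 1 m, (-1 : ℝ) ^ l • antiP₂ l (Function.update φ (m + 1)
            ((-1 : ℝ) ^ (m + 1) • partialP (m + 1) (partialP (m + 1) L)) l) =
          ∑ l ∈ Finset.Icc 1 m, (-1 : ℝ) ^ l • antiP₂ l (φ l) :=
        Finset.sum_congr rfl fun l hl => by
          rw [Function.update_of_ne (by have := Finset.mem_Icc.1 hl; omega)]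
      have hsq (F : Jet → ℝ) : (-1 : ℝ) ^ (m + 1) • antiP₂ (m + 1) ((-1 : ℝ) ^ (m + 1) • F) =
          antiP₂ (m + 1) F := by
        funext z
        simp only [antiP₂, Pi.smul_apply, smul_eq_mul, intervalIntegral.integral_const_mul]
        rw [← mul_assoc, ← mul_pow]
        simp
      rw [Finset.sum_Icc_succ_top (by omega), hS, Function.update_self,
        Function.update_of_ne (by omega), hsq, totalD_add M hN' hB,
        totalD_eq_add_coord_mul hB (by omega : m < M), hb'.partialP_antiP]
      have h' := h M (by omega)
      conv_lhs => rw [hT]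
      rw [sub_eq_iff_eq_add] at h'
      rw [h']
      abel

/-- The same decomposition, with the double primitive in the highest variable set apart. -/
theorem exists_eq_lagrangian {n : ℕ} (hn : 1 ≤ n) {L : Jet → ℝ} (hL : SmoothOfOrder n L) :
    ∃ (σ : Jet → ℝ) (φ : ℕ → Jet → ℝ) (N : Jet → ℝ), SmoothOfOrder n σ ∧
      (∀ k < n, SmoothOfOrder k (φ k)) ∧ SmoothOfOrder (n - 1) N ∧ L = lagrangian n σ φ N := by
  obtain ⟨φ, N, hφ, hN, h⟩ := exists_eq_sum_antiP₂ n hL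
  refine ⟨φ n, φ, N, hφ n le_rfl, fun k hk => hφ k hk.le, hN, ?_⟩
  obtain ⟨m, rfl⟩ := Nat.exists_eq_add_of_le' hn
  have h' := h (m + 1) le_rfl
  rw [Finset.sum_Icc_succ_top (by omega)] at h'
  rw [lagrangian, Nat.add_sub_cancel, h']
  abel

/-! ### The multiplier problem -/

theorem SmoothOfOrder.apply_update {m k : ℕ} {F : Jet → ℝ} (hF : SmoothOfOrder m F) (h : m < k)
    (x : ℝ) (p : ℕ → ℝ) (t : ℝ) : F (x, Function.update p k t) = F (x, p) := by
  obtain ⟨g, -, e⟩ := hF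
  rw [e, e]
  congr 2
  funext i
  rw [Function.update_of_ne (by omega)]

/-- A function that is affine in a variable `p_k` has only one linear coefficient. -/
theorem eq_of_mul_coord_add {m k : ℕ} (h : m < k) {a b a' b' : Jet → ℝ} (ha : SmoothOfOrder m a)
    (hb : SmoothOfOrder m b) (ha' : SmoothOfOrder m a') (hb' : SmoothOfOrder m b')
    (e : ∀ z : Jet, z.2 k * a z + b z = z.2 k * a' z + b' z) : a = a' := by
  funext ⟨x, p⟩
  have h0 := e (x, Function.update p k 0)
  have h1 := e (x, Function.update p k 1)
  simp only [ha.apply_update h, hb.apply_update h, ha'.apply_update h, hb'.apply_update h,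
    Function.update_self] at h0 h1
  linarith

section Multiplier

variable {n : ℕ} {R N f ρ L : Jet → ℝ} {φ : ℕ → Jet → ℝ}

/-- The integral form, in terms of `lagrangian` and `lowerPart`. -/
theorem hasIntegralForm_iff : HasIntegralForm n R φ N f ρ L ↔
    f = (n : ℝ) • (totalD (n + 1) R * coord (2 * n - 1)) -
        (fun z => Real.exp (R z)) * lowerPart n (fun z => Real.exp (-R z)) φ ∧
      ρ = (fun z => Real.exp (-R z)) ∧ L = lagrangian n (fun z => Real.exp (-R z)) φ N := by
  constructor
  · rintro ⟨hf, hρ, hL⟩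
    refine ⟨funext fun z => ?_, funext hρ, funext fun z => ?_⟩
    · rw [hf]
      simp [lowerPart, coord, Finset.sum_apply, mul_assoc]
    · rw [hL]
      simp [lagrangian, Finset.sum_apply]
  · rintro ⟨rfl, rfl, rfl⟩
    refine ⟨fun z => ?_, fun _ => rfl, fun z => ?_⟩
    · simp [lowerPart, coord, Finset.sum_apply, mul_assoc]
    · simp [lagrangian, Finset.sum_apply]

theorem totalD_exp_neg {m : ℕ} (M : ℕ) (hR : SmoothOfOrder m R) :
    totalD M (fun z => Real.exp (-R z)) = -((fun z => Real.exp (-R z)) * totalD M R) := by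
  have h := totalD_exp M (hR.const_smul (-1))
  rw [totalD_const_smul] at h
  simpa using h

/-- The equation of the multiplier problem for a Lagrangian `lagrangian n (e^{-R}) φ N` can be
solved for `f`. -/
theorem multiplier_eq_iff (hn : 3 ≤ n) (hR : SmoothOfOrder n R)
    (hφ : ∀ k < n, SmoothOfOrder k (φ k)) (hN : SmoothOfOrder (n - 1) N) (z : Jet) :
    Real.exp (-R z) * (z.2 (2 * n) - f z) =
        eulerLagrange (2 * n) n (lagrangian n (fun z => Real.exp (-R z)) φ N) z ↔
      f z = ((n : ℝ) • (totalD (n + 1) R * coord (2 * n - 1)) -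
        (fun z => Real.exp (R z)) * lowerPart n (fun z => Real.exp (-R z)) φ) z := by
  have hρ : SmoothOfOrder n fun z => Real.exp (-R z) := hR.neg.exp
  rw [eulerLagrange_lagrangian hn hρ hφ hN, totalD_exp_neg (n + 1) hR]
  simp only [Pi.add_apply, Pi.sub_apply, Pi.smul_apply, Pi.mul_apply, Pi.neg_apply, smul_eq_mul,
    coord]
  generalize lowerPart n (fun z => Real.exp (-R z)) φ z = B
  rw [Real.exp_neg]
  have h := (Real.exp_pos (R z)).ne'
  constructor
  · intro e
    field_simp at e
    linarith
  · intro e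
    rw [e]
    field_simp
    ring

theorem HasIntegralForm.solves (hn : 3 ≤ n) (hR : SmoothOfOrder n R)
    (hφ : ∀ k < n, SmoothOfOrder k (φ k)) (hN : SmoothOfOrder (n - 1) N)
    (h : HasIntegralForm n R φ N f ρ L) : SolvesMultiplierProblem n f ρ L := by
  obtain ⟨hf, rfl, rfl⟩ := hasIntegralForm_iff.1 h
  have hρ : SmoothOfOrder n fun z => Real.exp (-R z) := hR.neg.exp
  refine ⟨?_, hρ, smoothOfOrder_lagrangian hρ hφ hN (by omega), fun _ => Real.exp_pos _,
    fun z => (multiplier_eq_iff hn hR hφ hN z).2 (congrFun hf z)⟩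
  rw [hf]
  exact ((((hR.totalD (n + 1)).mono (by omega)).mul (SmoothOfOrder.coord le_rfl)).const_smul _).sub
    ((hR.exp.mono (by omega)).mul ((smoothOfOrder_lowerPart hρ hφ (by omega)).mono (by omega)))

theorem SolvesMultiplierProblem.exists_hasIntegralForm (hn : 3 ≤ n)
    (h : SolvesMultiplierProblem n f ρ L) :
    ∃ (R : Jet → ℝ) (φ : ℕ → Jet → ℝ) (N : Jet → ℝ),
      SmoothOfOrder n R ∧ (∀ k < n, SmoothOfOrder k (φ k)) ∧ SmoothOfOrder (n - 1) N ∧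
        HasIntegralForm n R φ N f ρ L := by
  obtain ⟨σ, φ, N, hσ, hφ, hN, hL⟩ := exists_eq_lagrangian (by omega) h.smooth_L
  have hE := eulerLagrange_lagrangian hn hσ hφ hN
  rw [← hL] at hE
  -- comparison of the coefficients of `p_{2n}`
  have hρσ : ρ = σ := by
    refine eq_of_mul_coord_add (k := 2 * n) (m := 2 * n - 1) (by omega)
      (b := -(ρ * f)) (b' := (n : ℝ) • (coord (2 * n - 1) * totalD (n + 1) σ) + lowerPart n σ φ)
      (h.smooth_ρ.mono (by omega)) ((h.smooth_ρ.mono (by omega)).mul h.smooth_f).neg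
      (hσ.mono (by omega)) ?_ fun z => ?_
    · exact (((SmoothOfOrder.coord le_rfl).mul ((hσ.totalD (n + 1)).mono (by omega))).const_smul
        _).add ((smoothOfOrder_lowerPart hσ hφ (by omega)).mono (by omega))
    · have e := h.eq z
      rw [hE] at e
      simp only [Pi.add_apply, Pi.mul_apply, Pi.neg_apply, coord] at e ⊢
      linarith
  have hR : SmoothOfOrder n (-fun z => Real.log (ρ z)) :=
    (h.smooth_ρ.log fun z => (h.pos z).ne').neg
  have hexp : ρ = fun z => Real.exp (-(-fun z => Real.log (ρ z)) z) := by
    funext z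
    simp [Real.exp_log (h.pos z)]
  rw [← hρσ, hexp] at hL
  refine ⟨_, φ, N, hR, hφ, hN, hasIntegralForm_iff.2 ⟨funext fun z => ?_, hexp, hL⟩⟩
  rw [← multiplier_eq_iff hn hR hφ hN z, ← hL, ← h.eq z, ← congrFun hexp z]

theorem HasIntegralForm.exists_affine (hn : 3 ≤ n) (hR : SmoothOfOrder n R)
    (hφ : ∀ k < n, SmoothOfOrder k (φ k)) (h : HasIntegralForm n R φ N f ρ L) :
    ∃ a b : Jet → ℝ, SmoothOfOrder (2 * n - 2) a ∧ SmoothOfOrder (2 * n - 2) b ∧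
      ∀ z : Jet, f z = a z * z.2 (2 * n - 1) + b z := by
  obtain ⟨hf, -, -⟩ := hasIntegralForm_iff.1 h
  refine ⟨(n : ℝ) • totalD (n + 1) R, -((fun z => Real.exp (R z)) *
      lowerPart n (fun z => Real.exp (-R z)) φ),
    ((hR.totalD (n + 1)).mono (by omega)).const_smul _,
    ((hR.exp.mono (by omega)).mul (smoothOfOrder_lowerPart hR.neg.exp hφ (by omega))).neg,
    fun z => ?_⟩
  rw [hf]
  simp [coord, mul_assoc, sub_eq_add_neg]

end Multiplier

end MultiplierProblem

theorem theoremB (n : ℕ) (hn : 3 ≤ n) (f ρ L : Jet → ℝ) :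
    (SolvesMultiplierProblem n f ρ L ↔
      ∃ (R : Jet → ℝ) (φ : ℕ → Jet → ℝ) (N : Jet → ℝ),
        SmoothOfOrder n R ∧ (∀ k < n, SmoothOfOrder k (φ k)) ∧ SmoothOfOrder (n - 1) N ∧
          HasIntegralForm n R φ N f ρ L) ∧
    (SolvesMultiplierProblem n f ρ L →
      ∃ a b : Jet → ℝ, SmoothOfOrder (2 * n - 2) a ∧ SmoothOfOrder (2 * n - 2) b ∧
        ∀ z : Jet, f z = a z * z.2 (2 * n - 1) + b z) := by
  refine ⟨⟨fun h => h.exists_hasIntegralForm hn, ?_⟩, fun h => ?_⟩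
  · rintro ⟨R, φ, N, hR, hφ, hN, h⟩
    exact h.solves hn hR hφ hN
  · obtain ⟨R, φ, N, hR, hφ, -, h'⟩ := h.exists_hasIntegralForm hn
    exact h'.exists_affine hn hR hφ
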